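/- Let $A$ be a (not necessarily unital) $C^*$-algebra with center $Z(A)$, and let $\mathrm{Prim}(A)$ be the set of its primitive ideals (kernels of nonzero irreducible $*$-representations on Hilbert spaces) with the hull-kernel topology. Call $A$ quasicentral if no primitive ideal of $A$ contains $Z(A)$. Write $P_1\approx P_2$ for $P_1,P_2\in\mathrm{Prim}(A)$ if $f(P_1)=f(P_2)$ for every bounded continuous $f:\mathrm{Prim}(A)\to\mathbb{R}$. Let $\mathrm{Glimm}(A)$ be the set of the ideals $q_A(P)=\bigcap\{Q\in\mathrm{Prim}(A) : Q\approx P\}$, $P\in\mathrm{Prim}(A)$, and let $\tau_{cr}$ be the weakest topology on $\mathrm{Glimm}(A)$ for which every function $g:\mathrm{Glimm}(A)\to\mathbb{R}$ with $g\circ q_A$ bounded and continuous on $\mathrm{Prim}(A)$ is continuous. Suppose that $A$ is quasicentral and has a countable approximate identity, i.e. there is a sequence $(e_n)$ in $A$ with $e_na\to a$ and $ae_n\to a$ for all $a\in A$. Then there is an element $z\in Z(A)$ that is strictly positive for $A$ (that is, $z\ge 0$ and $zAz$ is dense in $A$), and such that for every $\tau_{cr}$-compact set $K\subset\mathrm{Glimm}(A)$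 there is $\alpha>0$ with $$K\subset\{G\in\mathrm{Glimm}(A) : \|z+G\|\ge\alpha\},$$ where $\|z+G\|$ is the norm of the image of $z$ in $A/G$. -/

import Mathlib

universe u

noncomputable section

namespace GlimmSpace

/-- A `*`-representation of `A` on a Hilbert space `H` is irreducible if it is nonzero and the only
closed invariant subspaces are `0` and `H`. -/
def IsIrreducibleRep {A : Type*} [NonUnitalCStarAlgebra A]
    {H : Type*} [NormedAddCommGroup H] [InnerProductSpace ℂ H] [CompleteSpace H]
    (π : A →⋆ₙₐ[ℂ] (H →L[ℂ] H)) : Prop :=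
  (∃ a, π a ≠ 0) ∧
    ∀ M : Submodule ℂ H, IsClosed (M : Set H) → (∀ a, ∀ x ∈ M, π a x ∈ M) → M = ⊥ ∨ M = ⊤

/-- A primitive ideal of `A` is the kernel of an irreducible `*`-representation. Every irreducible
representation of `A` is cyclic, so Hilbert spaces in the universe of `A` suffice. -/
def IsPrimitiveIdeal {A : Type u} [NonUnitalCStarAlgebra A] (P : Submodule ℂ A) : Prop :=
  ∃ (H : Type u) (_ : NormedAddCommGroup H) (_ : InnerProductSpace ℂ H) (_ : CompleteSpace H)
    (π : A →⋆ₙₐ[ℂ] (H →L[ℂ] H)), IsIrreducibleRep π ∧ ∀ a, a ∈ P ↔ π a = 0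

/-- `Prim(A)`, the set of primitive ideals of `A`. -/
def Prim (A : Type u) [NonUnitalCStarAlgebra A] : Type u :=
  {P : Submodule ℂ A // IsPrimitiveIdeal P}

variable {A : Type u} [NonUnitalCStarAlgebra A]

/-- The hull of a subset of `A`: all primitive ideals that contain it. -/
def hull (S : Set A) : Set (Prim A) := {P | S ⊆ (P.1 : Set A)}

/-- Primitive ideals are prime. -/
theorem IsPrimitiveIdeal.prime {P : Submodule ℂ A} (hP : IsPrimitiveIdeal P) {x y : A}
    (h : ∀ a, x * a * y ∈ P) : x ∈ P ∨ y ∈ P := by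
  obtain ⟨H, _, _, _, π, ⟨⟨b, hb⟩, hirr⟩, hker⟩ := hP
  by_contra! hxy
  obtain ⟨hx, hy⟩ := hxy
  rw [hker] at hx hy
  -- vectors killed by `π(x)π(A)`
  let N : Submodule ℂ H :=
    { carrier := {v | ∀ a, π x (π a v) = 0}
      add_mem' := fun {v w} hv hw a => by
        have h1 := hv a
        have h2 := hw a
        simp [h1, h2]
      zero_mem' := fun a => by simp
      smul_mem' := fun c v hv a => by
        have h1 := hv a
        simp [h1] }
  have hNc : IsClosed (N : Set H) := by
    have : (N : Set H) = ⋂ a, {v | π x (π a v) = 0} := by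
      ext v; simp [N]
    rw [this]
    exact isClosed_iInter fun a => isClosed_eq (by fun_prop) continuous_const
  have hNi : ∀ a, ∀ v ∈ N, π a v ∈ N := fun a v hv c => by
    have := hv (c * a)
    simpa [map_mul] using this
  have hyN : ∀ v, π y v ∈ N := fun v a => by
    have h1 : π (x * a * y) = 0 := (hker _).1 (h a)
    have h2 : π (x * a * y) v = 0 := by rw [h1]; rfl
    simpa [map_mul] using h2
  rcases hirr N hNc hNi with h0 | h1
  · refine hy (ContinuousLinearMap.ext fun v => ?_)
    have := hyN v
    rw [h0] at this
    simpa using this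
  · -- `π(x)` vanishes on `π(A)H`, whose closed span is all of `H`
    let M : Submodule ℂ H := (Submodule.span ℂ {w | ∃ a v, w = π a v}).topologicalClosure
    have hMi : ∀ a, ∀ w ∈ M, π a w ∈ M := fun a w _ =>
      Submodule.le_topologicalClosure _ (Submodule.subset_span ⟨a, w, rfl⟩)
    rcases hirr M (Submodule.isClosed_topologicalClosure _) hMi with hM | hM
    · refine hb (ContinuousLinearMap.ext fun v => ?_)
      have : π b v ∈ M := Submodule.le_topologicalClosure _ (Submodule.subset_span ⟨b, v, rfl⟩)
      rw [hM] at this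
      simpa using this
    · have hle : M ≤ LinearMap.ker (π x).toLinearMap := by
        refine Submodule.topologicalClosure_minimal _ (Submodule.span_le.2 ?_)
          (ContinuousLinearMap.isClosed_ker (π x))
        rintro w ⟨a, v, rfl⟩
        have : v ∈ N := by rw [h1]; trivial
        exact this a
      refine hx (ContinuousLinearMap.ext fun v => ?_)
      have : v ∈ M := by rw [hM]; trivial
      exact hle this

/-- Primitive ideals are two-sided ideals. -/
theorem IsPrimitiveIdeal.mul_mem {P : Submodule ℂ A} (hP : IsPrimitiveIdeal P) {x : A}
    (hx : x ∈ P) (a b : A) : a * x ∈ P ∧ x * b ∈ P := by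
  obtain ⟨H, _, _, _, π, -, hker⟩ := hP
  rw [hker] at hx
  simp [hker, hx]

/-- The hull-kernel topology on `Prim(A)`: the closed sets are exactly the hulls. -/
instance : TopologicalSpace (Prim A) :=
  TopologicalSpace.ofClosed {C | ∃ S : Set A, C = hull S}
    (by
      obtain h : (∅ : Set (Prim A)) = hull Set.univ := by
        refine (Set.eq_empty_of_forall_notMem fun P hP => ?_).symm
        obtain ⟨H, _, _, _, π, ⟨⟨b, hb⟩, -⟩, hker⟩ := P.2
        exact hb ((hker b).1 (hP trivial))
      exact ⟨_, h⟩)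
    (by
      intro 𝒞 h𝒞
      refine ⟨{a | ∃ S : Set A, hull S ∈ 𝒞 ∧ a ∈ S}, ?_⟩
      ext P
      constructor
      · rintro hP a ⟨S, hS, ha⟩
        exact hP _ hS ha
      · intro hP C hC
        obtain ⟨S, rfl⟩ := h𝒞 hC
        exact fun a ha => hP ⟨S, hC, ha⟩)
    (by
      rintro _ ⟨S, rfl⟩ _ ⟨T, rfl⟩
      refine ⟨{c | ∃ x ∈ S, ∃ a, ∃ y ∈ T, c = x * a * y}, ?_⟩
      ext P
      constructor
      · rintro (hP | hP) c ⟨x, hx, a, y, hy, rfl⟩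
        · exact (P.2.mul_mem ((P.2.mul_mem (hP hx) a a).2) y y).2
        · exact (P.2.mul_mem (hP hy) (x * a) a).1
      · intro hP
        by_contra hcon
        simp only [Set.mem_union, not_or] at hcon
        obtain ⟨x, hx, hxP⟩ := Set.not_subset.1 hcon.1
        obtain ⟨y, hy, hyP⟩ := Set.not_subset.1 hcon.2
        rcases P.2.prime (x := x) (y := y) fun a => hP ⟨x, hx, a, y, hy, rfl⟩ with h | h
        · exact hxP h
        · exact hyP h)

theorem isClosed_iff_hull {C : Set (Prim A)} : IsClosed C ↔ ∃ S : Set A, C = hull S := by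
  rw [← isOpen_compl_iff]
  change Cᶜᶜ ∈ {C | ∃ S : Set A, C = hull S} ↔ _
  rw [compl_compl]
  rfl

/-- `P₁ ≈ P₂`: the bounded continuous real functions on `Prim(A)` do not separate `P₁`, `P₂`. -/
def Equivalent (P₁ P₂ : Prim A) : Prop :=
  ∀ f : BoundedContinuousFunction (Prim A) ℝ, f P₁ = f P₂

/-- The kernel (intersection) of the equivalence class of `P`. -/
def glimmIdeal (P : Prim A) : Submodule ℂ A :=
  ⨅ Q : {Q : Prim A // Equivalent Q P}, Q.1.1

variable (A) in
/-- `Glimm(A)`, the set of kernels of equivalence classes of primitive ideals. -/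
def Glimm : Type u := {G : Submodule ℂ A // ∃ P : Prim A, G = glimmIdeal P}

/-- The quotient map `q_A : Prim(A) → Glimm(A)`. -/
def quotientMap (P : Prim A) : Glimm A := ⟨glimmIdeal P, P, rfl⟩

/-- Every bounded continuous real function on `Prim(A)` drops to `Glimm(A)`. -/
theorem exists_drop (f : BoundedContinuousFunction (Prim A) ℝ) :
    ∃ g : Glimm A → ℝ, ∀ P, g (quotientMap P) = f P := by
  have key : ∀ P₁ P₂ : Prim A, glimmIdeal P₁ = glimmIdeal P₂ → f P₁ = f P₂ := by
    intro P₁ P₂ h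
    have hc : IsClosed {Q : Prim A | f Q = f P₁} := isClosed_eq f.continuous continuous_const
    obtain ⟨S, hS⟩ := isClosed_iff_hull.1 hc
    have h1 : S ⊆ (glimmIdeal P₁ : Set A) := by
      intro a ha
      refine (Submodule.mem_iInf _).2 fun Q => ?_
      have : Q.1 ∈ hull S := by rw [← hS]; exact Q.2 f
      exact this ha
    have h2 : P₂ ∈ hull S := fun a ha => by
      have := h1 ha
      rw [h] at this
      exact (Submodule.mem_iInf _).1 this ⟨P₂, fun _ => rfl⟩
    rw [← hS] at h2
    exact h2.symm
  refine ⟨fun G => f G.2.choose, fun P => key _ _ ?_⟩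
  exact (quotientMap P).2.choose_spec.symm

/-- The topology `τ_cr`: the weakest topology on `Glimm(A)` making continuous all functions `g`
obtained by dropping to `Glimm(A)` a bounded continuous real function on `Prim(A)`, that is, all `g`
such that `g ∘ q_A` is a bounded continuous function `f` on `Prim(A)`. -/
instance : TopologicalSpace (Glimm A) :=
  ⨅ g : {g : Glimm A → ℝ // ∃ f : BoundedContinuousFunction (Prim A) ℝ, ∀ P, g (quotientMap P) = f P},
    TopologicalSpace.induced g.1 inferInstance

variable (A) in
/-- `A` is quasicentral if no primitive ideal contains the center of `A`. -/
def IsQuasicentral : Prop := ∀ P : Prim A, ¬ Set.center A ⊆ (P.1 : Set A)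

variable (A) in
/-- `A` has a countable approximate identity: a sequence `e` with `e n * a → a` and
`a * e n → a` for all `a`. -/
def HasCountableApproximateIdentity : Prop :=
  ∃ e : ℕ → A, (Filter.map e Filter.atTop).IsApproximateUnit

/-- `a` is strictly positive for `A`: it is positive and `aAa` is dense in `A`. -/
def IsStrictlyPositiveFor [PartialOrder A] (a : A) : Prop :=
  0 ≤ a ∧ Dense {y : A | ∃ x : A, y = a * x * a}

end GlimmSpace

end

namespace GlimmSpace

/-! ### States vanishing on a closed ideal -/

section Unital

variable {B : Type*} [CStarAlgebra B]

/-! It suffices to find a central `z ≥ 0` that lies in no primitive ideal. A proper closed ideal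
lies in a primitive one (`exists_prim_of_notMem`, by Hahn–Banach, Krein–Milman and GNS), so
quasicentrality makes the closed ideal generated by the center all of `A`. Each term of the
countable approximate identity is then a limit of finite sums of products `w * a` with `w` central,
so countably many central `w n` already escape every primitive ideal (`exists_seq_center`). A
convergent weighted sum of the `star (w n) * w n` is the required `z`.

Strict positivity: `z * z` also lies in no primitive ideal, so it generates `A` as a closed ideal,
and `z * z * a = z * a * z`.

Compact sets: modulo each primitive `P`, `z` is a nonzero real scalar `r P` (`exists_scalar`), and
functional calculus on `z` shows that `r` is continuous on `Prim A`. It drops to a continuous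
function on `Glimm A`, whose absolute value has a positive minimum on a nonempty compact set and is
dominated by the quotient norm of `z`. -/

instance weakDual_locallyConvexSpace {E : Type*} [NormedAddCommGroup E] [NormedSpace ℝ E] :
    LocallyConvexSpace ℝ (WeakDual ℝ E) :=
  inferInstanceAs (LocallyConvexSpace ℝ (WeakBilin (topDualPairing ℝ E)))

/-- The states of a unital C⋆-algebra that vanish on `J`, given by their real parts. -/
def stateSet (J : Submodule ℂ B) : Set (WeakDual ℝ B) :=
  {f | (∀ x, 0 ≤ f (star x * x)) ∧ (∀ x, f (star x) = f x) ∧ f 1 = 1 ∧ ∀ j ∈ J, f j = 0}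

theorem isClosed_stateSet (J : Submodule ℂ B) : IsClosed (stateSet J) := by
  have h (x : B) : Continuous fun f : WeakDual ℝ B => f x := WeakDual.eval_continuous x
  simp only [stateSet, Set.ofPred_and, Set.ofPred_forall]
  refine (isClosed_iInter fun x => isClosed_le continuous_const (h _)).inter
    ((isClosed_iInter fun x => isClosed_eq (h _) (h _)).inter
    ((isClosed_eq (h _) continuous_const).inter
      (isClosed_iInter fun j => isClosed_iInter fun _ => isClosed_eq (h _) continuous_const)))

theorem convex_stateSet (J : Submodule ℂ B) : Convex ℝ (stateSet J) := by
  rintro f ⟨hf1, hf2, hf3, hf4⟩ g ⟨hg1, hg2, hg3, hg4⟩ s t hs ht hst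
  have key (x : B) : (s • f + t • g) x = s * f x + t * g x := rfl
  refine ⟨fun x => ?_, fun x => ?_, ?_, fun j hj => ?_⟩
  · rw [key]; exact add_nonneg (mul_nonneg hs (hf1 x)) (mul_nonneg ht (hg1 x))
  · rw [key, key, hf2, hg2]
  · rw [key, hf3, hg3, mul_one, mul_one, hst]
  · rw [key, hf4 j hj, hg4 j hj, mul_zero, mul_zero, add_zero]

/-- A self-adjoint `y` satisfies `y ≤ ‖y‖ · 1`. For general `x`, hermitian symmetry gives `f (x +
star x) = 2 * f x`, which reduces to that case. -/
theorem abs_apply_le_of_positive [PartialOrder B] [StarOrderedRing B] {f : B →ₗ[ℝ] ℝ}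
    (hf : ∀ x, 0 ≤ f (star x * x)) (hstar : ∀ x, f (star x) = f x) (x : B) :
    |f x| ≤ f 1 * ‖x‖ := by
  have hpos (y : B) (hy : 0 ≤ y) : 0 ≤ f y := by
    obtain ⟨s, rfl⟩ := CStarAlgebra.nonneg_iff_eq_star_mul_self.1 hy
    exact hf s
  have hsa (y : B) (hy : IsSelfAdjoint y) : f y ≤ f 1 * ‖y‖ := by
    have := hpos _ (sub_nonneg.2 (IsSelfAdjoint.le_algebraMap_norm_self hy))
    rw [map_sub, Algebra.algebraMap_eq_smul_one, map_smul, smul_eq_mul] at this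
    linarith
  have h1 : 0 ≤ f 1 := by simpa using hf 1
  have hle (y : B) : f y ≤ f 1 * ‖y‖ := by
    have h2 : f (y + star y) ≤ f 1 * ‖y + star y‖ := hsa _ (IsSelfAdjoint.add_star_self y)
    have h3 : ‖y + star y‖ ≤ 2 * ‖y‖ := by
      have := norm_add_le y (star y)
      rw [norm_star] at this
      linarith
    rw [map_add, hstar] at h2
    nlinarith
  refine abs_le.2 ⟨?_, hle x⟩
  have := hle (-x)
  rw [map_neg, norm_neg] at this
  linarith

/-- States have norm at most `f 1 = 1`, so Banach–Alaoglu applies. -/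
theorem isCompact_stateSet (J : Submodule ℂ B) : IsCompact (stateSet J) := by
  let _ := CStarAlgebra.spectralOrder B
  have _ := CStarAlgebra.spectralOrderedRing B
  refine (WeakDual.isCompact_closedBall (𝕜 := ℝ) (E := B) 0 1).of_isClosed_subset
    (isClosed_stateSet J) ?_
  rintro f ⟨hf1, hf2, hf3, -⟩
  rw [Set.mem_preimage, mem_closedBall_zero_iff]
  refine ContinuousLinearMap.opNorm_le_bound _ zero_le_one fun x => ?_
  have := abs_apply_le_of_positive (f := (WeakDual.toStrongDual f).toLinearMap) hf1 hf2 x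
  have h1 : (WeakDual.toStrongDual f).toLinearMap 1 = 1 := hf3
  rw [h1] at this
  exact this

/-- Modulo a closed ideal, `b⋆b ≤ δ + h` with `h` in the ideal bounds the distance of `b`. -/
theorem exists_mem_norm_sub_sq_le [PartialOrder B] [StarOrderedRing B] (J : Submodule ℂ B)
    (hJ : ∀ j ∈ J, ∀ x, x * j ∈ J) {b h : B} (hh : h ∈ J)
    (hsa : IsSelfAdjoint h) {δ ε : ℝ} (hδ : 0 ≤ δ) (hε : 0 < ε)
    (hb : star b * b ≤ algebraMap ℝ B δ + h) : ∃ k ∈ J, ‖b - k‖ ^ 2 ≤ δ + ε := by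
  -- The cutoff `c = w(h)` with `w t = 1 / (1 + t² / ε²)` is small where `h` is large: `|t| * w t ≤
  -- ε`, hence `‖c * h * c‖ ≤ ε`. Since `1 - c` is a multiple of `h`, the element `k = b * (1 - c)`
  -- lies in the ideal, and `b - k = b * c`.
  let n : ℝ := (ε⁻¹) ^ 2
  have hn : 0 ≤ n := sq_nonneg _
  have hpos (t : ℝ) : 0 < 1 + n * t ^ 2 := by positivity
  obtain ⟨w, hw, hcont⟩ : ∃ w : ℝ → ℝ, (∀ t, w t = (1 + n * t ^ 2)⁻¹) ∧ Continuous w :=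
    ⟨_, fun _ => rfl, Continuous.inv₀ (by fun_prop) fun t => (hpos t).ne'⟩
  let c : B := cfc w h
  have hc : IsSelfAdjoint c := cfc_predicate _ _
  have hc1 : 1 - c = cfc (fun t : ℝ => w t * (n * t)) h * h := by
    have e2 : cfc (fun t : ℝ => w t * (n * t)) h * h = cfc (fun t : ℝ => w t * (n * t) * t) h := by
      rw [cfc_mul (fun t => w t * (n * t)) (fun t => t) h (by fun_prop) (by fun_prop),
        cfc_id' ℝ h]
    rw [e2, ← cfc_const_one ℝ h]
    change _ - cfc _ h = _
    rw [← cfc_sub _ _ h (by fun_prop) (by fun_prop)]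
    congr 1
    funext t
    have := hpos t
    rw [hw]
    field_simp
    ring
  have hch : c * h * c = cfc (fun t : ℝ => w t * t * w t) h := by
    rw [cfc_mul (fun t => w t * t) w h (by fun_prop) (by fun_prop),
      cfc_mul w (fun t => t) h (by fun_prop) (by fun_prop), cfc_id' ℝ h]
  have hchn : ‖c * h * c‖ ≤ ε := by
    rw [hch]
    refine norm_cfc_le hε.le fun t _ => ?_
    have := hpos t
    rw [hw, Real.norm_eq_abs, abs_mul, abs_mul, abs_of_pos (inv_pos.2 this)]
    have h1 : (1 + n * t ^ 2)⁻¹ ≤ 1 := inv_le_one_of_one_le₀ (by nlinarith [sq_nonneg t])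
    have h2 : (1 + n * t ^ 2)⁻¹ * |t| ≤ ε := by
      rw [inv_mul_le_iff₀ this]
      have h3 : n * t ^ 2 = (ε⁻¹ * |t|) ^ 2 := by rw [mul_pow, sq_abs]
      have h4 : |t| = (ε⁻¹ * |t|) * ε := by field_simp
      rw [h3]
      nlinarith [sq_nonneg (ε⁻¹ * |t| - 1), sq_nonneg (ε⁻¹ * |t|)]
    have h5 := inv_pos.2 this
    nlinarith [abs_nonneg t]
  have hcn : ‖c‖ ≤ 1 := by
    refine norm_cfc_le zero_le_one fun t _ => ?_
    rw [hw, Real.norm_eq_abs, abs_of_pos (inv_pos.2 (hpos t))]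
    exact inv_le_one_of_one_le₀ (by nlinarith [sq_nonneg t])
  refine ⟨b * (1 - c), ?_, ?_⟩
  · rw [hc1, ← mul_assoc]; exact hJ _ hh _
  · have e : b - b * (1 - c) = b * c := by rw [mul_sub, mul_one, sub_sub_cancel]
    have e2 : star (b * c) * (b * c) = star c * (star b * b) * c := by
      rw [star_mul]; simp only [mul_assoc]
    rw [e, sq, ← CStarRing.norm_star_mul_self, e2]
    have h1 := star_left_conjugate_le_conjugate hb c
    refine (CStarAlgebra.norm_le_norm_of_nonneg_of_le
      (star_left_conjugate_nonneg (star_mul_self_nonneg b) c) h1).trans ?_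
    have e3 : star c * (algebraMap ℝ B δ + h) * c = δ • (c * c) + c * h * c := by
      rw [hc.star_eq, mul_add, add_mul, Algebra.algebraMap_eq_smul_one, mul_smul_comm, mul_one,
        smul_mul_assoc]
    rw [e3]
    refine (norm_add_le _ _).trans (add_le_add ?_ hchn)
    rw [norm_smul, Real.norm_of_nonneg hδ]
    have : ‖c * c‖ ≤ 1 := (norm_mul_le _ _).trans (mul_le_one₀ hcn (norm_nonneg _) hcn)
    nlinarith

/-- A closed ideal and an element `b⋆b` with `b` outside the ideal are separated by a state. -/
theorem exists_mem_stateSet (J : Submodule ℂ B) (hJc : IsClosed (J : Set B))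
    (hJ : ∀ j ∈ J, ∀ x, x * j ∈ J) (hJs : ∀ j ∈ J, star j ∈ J) {b : B} (hb : b ∉ J) :
    ∃ f ∈ stateSet J, f (star b * b) ≠ 0 := by
  let _ := CStarAlgebra.spectralOrder B
  have _ := CStarAlgebra.spectralOrderedRing B
  obtain ⟨r, hr, hrb⟩ : ∃ r > 0, ∀ k ∈ J, r ≤ ‖b - k‖ := by
    obtain ⟨r, hr, h⟩ := Metric.isOpen_iff.1 hJc.isOpen_compl b hb
    refine ⟨r, hr, fun k hk => ?_⟩
    by_contra! hlt
    exact h (by rwa [Metric.mem_ball, dist_comm, dist_eq_norm]) hk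
  -- The cone of elements whose real part is positive modulo `J`. A real functional that is
  -- nonnegative on it is automatically positive, hermitian and zero on `J`.
  let C : Set B := {x | ∃ j ∈ J, 0 ≤ x + star x + j}
  have hCconv : Convex ℝ C := by
    rintro x ⟨j, hj, hx⟩ y ⟨k, hk, hy⟩ s t hs ht -
    refine ⟨(s : ℂ) • j + (t : ℂ) • k, J.add_mem (J.smul_mem _ hj) (J.smul_mem _ hk), ?_⟩
    have := add_nonneg (smul_nonneg hs hx) (smul_nonneg ht hy)
    convert this using 1
    simp only [star_add, star_smul, smul_add, Complex.coe_smul, star_trivial]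
    abel
  -- If the ball met `C`, the distance estimate with `ε = δ` would give `‖b - k‖² ≤ 2δ = r² / 2 <
  -- r²`.
  let δ : ℝ := r ^ 2 / 4
  have hδ : 0 < δ := by positivity
  have hdisj : Disjoint (Metric.ball (-(star b * b)) δ) C := by
    rw [Set.disjoint_left]
    rintro x hx ⟨j, hj, hxj⟩
    rw [Metric.mem_ball, dist_eq_norm, sub_neg_eq_add] at hx
    set y := x + star b * b with hy
    have hsx : IsSelfAdjoint j := by
      have h1 := (IsSelfAdjoint.of_nonneg hxj).sub (IsSelfAdjoint.add_star_self x)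
      simpa using h1
    have hxy : x + star x + j = (y + star y + j) - (2 : ℝ) • (star b * b) := by
      simp only [hy, star_add, star_mul, star_star, two_smul]
      abel
    have h1 : y + star y ≤ algebraMap ℝ B (2 * δ) := by
      refine (IsSelfAdjoint.le_algebraMap_norm_self (IsSelfAdjoint.add_star_self y)).trans ?_
      refine algebraMap_mono B ?_
      have := norm_add_le y (star y)
      rw [norm_star] at this
      linarith
    have h2 : star b * b ≤ algebraMap ℝ B δ + (2 : ℝ)⁻¹ • j := by
      have h3 : (2 : ℝ) • (star b * b) ≤ algebraMap ℝ B (2 * δ) + j := by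
        rw [hxy] at hxj
        exact (sub_nonneg.1 hxj).trans (add_le_add_left h1 j)
      have h4 := smul_le_smul_of_nonneg_left h3 (by norm_num : (0 : ℝ) ≤ 2⁻¹)
      rw [smul_smul, smul_add, Algebra.algebraMap_eq_smul_one, smul_smul] at h4
      rw [Algebra.algebraMap_eq_smul_one]
      rwa [inv_mul_cancel_left₀ two_ne_zero, inv_mul_cancel₀ two_ne_zero, one_smul] at h4
    have hj2 : (2 : ℝ)⁻¹ • j ∈ J := by
      have := J.smul_mem ((2⁻¹ : ℝ) : ℂ) hj
      rwa [Complex.coe_smul] at this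
    obtain ⟨k, hk, hbk⟩ := exists_mem_norm_sub_sq_le J hJ hj2
      (IsSelfAdjoint.smul (IsSelfAdjoint.all _) hsx) hδ.le hδ h2
    have h5 := hrb k hk
    have h6 : r ^ 2 ≤ ‖b - k‖ ^ 2 := pow_le_pow_left₀ hr.le h5 2
    have : 0 < r ^ 2 := by positivity
    simp only [δ] at hbk
    linarith
  obtain ⟨f, u, hfu, hfC⟩ := geometric_hahn_banach_open (convex_ball _ _) Metric.isOpen_ball
    hCconv hdisj
  -- `C` is stable under scaling by naturals, so a negative value of `f` on it would be unbounded
  -- below.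
  have hfC0 (x : B) (hx : x ∈ C) : 0 ≤ f x := by
    by_contra! hlt
    obtain ⟨n, hn⟩ := exists_nat_gt (u / f x)
    have hmem : (n : ℝ) • x ∈ C := by
      obtain ⟨j, hj, hxj⟩ := hx
      refine ⟨((n : ℝ) : ℂ) • j, J.smul_mem _ hj, ?_⟩
      have := smul_nonneg (Nat.cast_nonneg' n : (0 : ℝ) ≤ n) hxj
      convert this using 1
      simp only [star_smul, smul_add, Complex.coe_smul, star_trivial]
    have := hfC _ hmem
    rw [map_smul, smul_eq_mul] at this
    rw [div_lt_iff_of_neg hlt] at hn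
    linarith
  have hf1 (x : B) : 0 ≤ f (star x * x) := by
    refine hfC0 _ ⟨0, J.zero_mem, ?_⟩
    rw [add_zero, star_mul, star_star]
    exact add_nonneg (star_mul_self_nonneg x) (star_mul_self_nonneg x)
  have hfs (x : B) : f (star x) = f x := by
    have h1 := hfC0 (x - star x) ⟨0, J.zero_mem, by simp⟩
    have h2 := hfC0 (star x - x) ⟨0, J.zero_mem, by simp⟩
    rw [map_sub] at h1 h2
    linarith
  have hfJ (j : B) (hj : j ∈ J) : f j = 0 := by
    have h1 (k : B) (hk : k ∈ J) : 0 ≤ f k :=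
      hfC0 k ⟨-(k + star k), J.neg_mem (J.add_mem hk (hJs k hk)), by simp⟩
    have h2 := h1 _ (J.neg_mem hj)
    rw [map_neg] at h2
    linarith [h1 j hj]
  have hfb : 0 < f (star b * b) := by
    have h1 := hfu _ (Metric.mem_ball_self hδ)
    have h2 := hfC 0 ⟨0, J.zero_mem, by simp⟩
    rw [map_neg] at h1
    rw [map_zero] at h2
    linarith
  have hone : 0 < f 1 := by
    have := abs_apply_le_of_positive (f := f.toLinearMap) hf1 hfs (star b * b)
    have h2 : f (star b * b) ≤ f 1 * ‖star b * b‖ := (le_abs_self _).trans this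
    by_contra! hle
    have := mul_nonpos_of_nonpos_of_nonneg hle (norm_nonneg (star b * b))
    linarith
  let g : WeakDual ℝ B := StrongDual.toWeakDual ((f 1)⁻¹ • f)
  have hg (x : B) : g x = (f 1)⁻¹ * f x := rfl
  refine ⟨g, ⟨fun x => ?_, fun x => ?_, ?_, fun j hj => ?_⟩, ?_⟩
  · rw [hg]; exact mul_nonneg (inv_pos.2 hone).le (hf1 x)
  · rw [hg, hg, hfs]
  · rw [hg, inv_mul_cancel₀ hone.ne']
  · rw [hg, hfJ j hj, mul_zero]
  · rw [hg]; exact (mul_pos (inv_pos.2 hone) hfb).ne'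

/-- Vanishing at `star b * b` is a closed convex condition, so by Krein–Milman it would pass from
the extreme points to all of `stateSet J`. -/
theorem exists_extreme_state (J : Submodule ℂ B) (hJc : IsClosed (J : Set B))
    (hJ : ∀ j ∈ J, ∀ x, x * j ∈ J) (hJs : ∀ j ∈ J, star j ∈ J) {b : B} (hb : b ∉ J) :
    ∃ f ∈ (stateSet J).extremePoints ℝ, f (star b * b) ≠ 0 := by
  obtain ⟨g, hg, hgb⟩ := exists_mem_stateSet J hJc hJ hJs hb
  by_contra! hcon
  let V : Set (WeakDual ℝ B) := {f | f (star b * b) = 0}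
  have hVc : IsClosed V := isClosed_eq (WeakDual.eval_continuous _) continuous_const
  have hVconv : Convex ℝ V := by
    intro f hf f' hf' s t _ _ _
    change s * f (star b * b) + t * f' (star b * b) = 0
    rw [show f (star b * b) = 0 from hf, show f' (star b * b) = 0 from hf', mul_zero, mul_zero,
      add_zero]
  have h1 : stateSet J ⊆ V := by
    rw [← closure_convexHull_extremePoints (isCompact_stateSet J) (convex_stateSet J)]
    exact closure_minimal (convexHull_min hcon hVconv) hVc
  exact hgb (h1 hg)

end Unital

end GlimmSpace

namespace GlimmSpace

open scoped ComplexOrder InnerProductSpace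

/-! ### From extreme states to irreducible representations -/

section Unital

variable {B : Type*} [CStarAlgebra B]

/-- The positive functional with a given hermitian positive real part. -/
noncomputable def complexState [PartialOrder B] [StarOrderedRing B] (f : WeakDual ℝ B)
    (hf : ∀ x, 0 ≤ f (star x * x)) (hstar : ∀ x, f (star x) = f x) : B →ₚ[ℂ] ℂ :=
  PositiveLinearMap.mk₀ (StrongDual.extendRCLike (𝕜 := ℂ) (WeakDual.toStrongDual f)).toLinearMap
    (by
      intro x hx
      -- `Complex.I • x` is skew-adjoint, and a hermitian real part vanishes on skew-adjoint
      -- elements.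
      have him : f (Complex.I • x) = 0 := by
        have := hstar (Complex.I • x)
        rw [star_smul, (IsSelfAdjoint.of_nonneg hx).star_eq] at this
        have h2 : star Complex.I • x = -(Complex.I • x) := by simp
        rw [h2, map_neg] at this
        linarith
      have hre : 0 ≤ f x := by
        obtain ⟨s, rfl⟩ := CStarAlgebra.nonneg_iff_eq_star_mul_self.1 hx
        exact hf s
      refine Complex.nonneg_iff.2 ⟨?_, ?_⟩
      · exact hre.trans_eq (StrongDual.re_extendRCLike_apply (𝕜 := ℂ) (WeakDual.toStrongDual f) x).symm
      · refine Eq.trans ?_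
          (StrongDual.im_extendRCLike_apply (𝕜 := ℂ) (WeakDual.toStrongDual f) x).symm
        exact (neg_eq_zero.2 him).symm)

theorem complexState_re [PartialOrder B] [StarOrderedRing B] {f : WeakDual ℝ B}
    (hf : ∀ x, 0 ≤ f (star x * x)) (hstar : ∀ x, f (star x) = f x) (x : B) :
    (complexState f hf hstar x).re = f x :=
  StrongDual.re_extendRCLike_apply (𝕜 := ℂ) (WeakDual.toStrongDual f) x

theorem complexState_im [PartialOrder B] [StarOrderedRing B] {f : WeakDual ℝ B}
    (hf : ∀ x, 0 ≤ f (star x * x)) (hstar : ∀ x, f (star x) = f x) (x : B) :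
    (complexState f hf hstar x).im = -f (Complex.I • x) :=
  StrongDual.im_extendRCLike_apply (𝕜 := ℂ) (WeakDual.toStrongDual f) x

end Unital

section Cyclic

variable {B : Type*} [CStarAlgebra B] {H : Type*} [NormedAddCommGroup H] [InnerProductSpace ℂ H]
  [CompleteSpace H] (π : B →⋆ₐ[ℂ] (H →L[ℂ] H))

theorem inner_map_left (x : B) (v w : H) : ⟪π x v, w⟫_ℂ = ⟪v, π (star x) w⟫_ℂ := by
  rw [map_star, ContinuousLinearMap.star_eq_adjoint, ContinuousLinearMap.adjoint_inner_right]

/-- The real part of the normalized vector state of `v`. -/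
noncomputable def vectorState (v : H) : WeakDual ℝ B :=
  StrongDual.toWeakDual ((‖v‖ ^ 2)⁻¹ • LinearMap.mkContinuous
    { toFun := fun x => (⟪v, π x v⟫_ℂ).re
      map_add' := fun x y => by simp
      map_smul' := fun r x => by
        rw [← Complex.coe_smul, map_smul]
        simp }
    (‖v‖ ^ 2) (fun x => by
      refine (Complex.abs_re_le_norm _).trans ((norm_inner_le_norm _ _).trans ?_)
      have h1 := (π x).le_opNorm v
      have h2 : ‖π x‖ ≤ ‖x‖ := NonUnitalStarAlgHom.norm_apply_le π x
      nlinarith [norm_nonneg v, norm_nonneg (π x v), mul_le_mul_of_nonneg_right h2 (norm_nonneg v)]))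

theorem vectorState_apply (v : H) (x : B) :
    vectorState π v x = (‖v‖ ^ 2)⁻¹ * (⟪v, π x v⟫_ℂ).re := rfl

theorem vectorState_mem {J : Submodule ℂ B} (hJ : ∀ j ∈ J, π j = 0) {v : H} (hv : v ≠ 0) :
    vectorState π v ∈ stateSet J := by
  refine ⟨fun x => ?_, fun x => ?_, ?_, fun j hj => ?_⟩
  · rw [vectorState_apply, map_mul, mul_apply_eq_comp, ← inner_map_left]
    exact mul_nonneg (by positivity) (inner_self_nonneg (𝕜 := ℂ))
  · rw [vectorState_apply, vectorState_apply, ← inner_map_left, ← inner_conj_symm,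
      Complex.conj_re]
  · have h1 : (⟪v, v⟫_ℂ).re = ‖v‖ ^ 2 := inner_self_eq_norm_sq (𝕜 := ℂ) v
    have h2 : ‖v‖ ≠ 0 := norm_ne_zero_iff.2 hv
    rw [vectorState_apply, map_one, one_apply_eq_self, h1]
    exact inv_mul_cancel₀ (by positivity)
  · simp [vectorState_apply, hJ j hj]

/-- A representation with a cyclic vector whose vector state is extreme is irreducible. -/
theorem irreducible_of_extreme {J : Submodule ℂ B} (hJ : ∀ j ∈ J, π j = 0) {ξ : H}
    (hξ : ‖ξ‖ = 1) (hcyc : Dense (Set.range fun x => π x ξ))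
    (hext : vectorState π ξ ∈ (stateSet J).extremePoints ℝ) (M : Submodule ℂ H)
    (hMc : IsClosed (M : Set H)) (hM : ∀ x, ∀ v ∈ M, π x v ∈ M) : M = ⊥ ∨ M = ⊤ := by
  have _ : CompleteSpace M := hMc.completeSpace_coe
  have hM' (x : B) (v : H) (hv : v ∈ Mᗮ) : π x v ∈ Mᗮ := by
    intro w hw
    rw [← star_star x, ← inner_map_left]
    exact hv _ (hM _ _ hw)
  have hfull (N : Submodule ℂ H) (hNc : IsClosed (N : Set H)) (hN : ∀ x, ∀ v ∈ N, π x v ∈ N)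
      (h : ξ ∈ N) : N = ⊤ := by
    refine eq_top_iff.2 fun v _ => ?_
    have : closure (Set.range fun x => π x ξ) ⊆ (N : Set H) :=
      closure_minimal (by rintro _ ⟨x, rfl⟩; exact hN x _ h) hNc
    exact this (hcyc v)
  obtain ⟨ξ₁, h₁, ξ₂, h₂, hsum⟩ := M.exists_add_mem_mem_orthogonal ξ
  by_cases hz1 : ξ₁ = 0
  · left
    rw [hz1, zero_add] at hsum
    have := hfull Mᗮ M.isClosed_orthogonal hM' (hsum ▸ h₂)
    rwa [Submodule.orthogonal_eq_top_iff] at this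
  by_cases hz2 : ξ₂ = 0
  · right
    rw [hz2, add_zero] at hsum
    exact hfull M hMc hM (hsum ▸ h₁)
  exfalso
  have ho12 (x : B) : ⟪ξ₁, π x ξ₂⟫_ℂ = 0 := hM' x _ h₂ _ h₁
  have ho21 (x : B) : ⟪ξ₂, π x ξ₁⟫_ℂ = 0 := (Submodule.mem_orthogonal' M ξ₂).1 h₂ _ (hM x _ h₁)
  have hn1 : ‖ξ₁‖ ≠ 0 := norm_ne_zero_iff.2 hz1
  have hn2 : ‖ξ₂‖ ≠ 0 := norm_ne_zero_iff.2 hz2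
  have hpyth : ‖ξ₁‖ ^ 2 + ‖ξ₂‖ ^ 2 = 1 := by
    have h3 := norm_add_sq_eq_norm_sq_add_norm_sq_of_inner_eq_zero ξ₁ ξ₂
      ((Submodule.mem_orthogonal M ξ₂).1 h₂ _ h₁ : ⟪ξ₁, ξ₂⟫_ℂ = 0)
    rw [← hsum, hξ] at h3
    nlinarith
  -- The invariant splitting `ξ = ξ₁ + ξ₂` exhibits the state of `ξ` as a proper convex combination.
  -- Extremality makes the state of `ξ₁` equal to that of `ξ`, and cyclicity then forces `ξ₁ = ‖ξ₁‖²
  -- • ξ`, so `ξ ∈ M` and `ξ₂ = 0`.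
  have hseg : vectorState π ξ ∈ openSegment ℝ (vectorState π ξ₁) (vectorState π ξ₂) := by
    refine ⟨‖ξ₁‖ ^ 2, ‖ξ₂‖ ^ 2, by positivity, by positivity, hpyth, ?_⟩
    refine DFunLike.ext _ _ fun x => ?_
    change ‖ξ₁‖ ^ 2 * vectorState π ξ₁ x + ‖ξ₂‖ ^ 2 * vectorState π ξ₂ x = _
    simp only [vectorState_apply]
    rw [mul_inv_cancel_left₀ (by positivity), mul_inv_cancel_left₀ (by positivity), hξ, hsum,
      map_add, inner_add_left, inner_add_right, inner_add_right, ho12, ho21]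
    simp
  have heq : vectorState π ξ₁ = vectorState π ξ :=
    ((mem_extremePoints.1 hext).2 _ (vectorState_mem π hJ hz1) _ (vectorState_mem π hJ hz2)
      hseg).1
  have hre (x : B) : (⟪ξ₁, π x ξ₁⟫_ℂ).re = ‖ξ₁‖ ^ 2 * (⟪ξ, π x ξ⟫_ℂ).re := by
    have h3 := DFunLike.congr_fun heq x
    rw [vectorState_apply, vectorState_apply, hξ] at h3
    rw [one_pow, inv_one, one_mul] at h3
    rw [← h3, mul_inv_cancel_left₀ (by positivity)]
  have hcx (x : B) : ⟪ξ₁, π x ξ₁⟫_ℂ = (‖ξ₁‖ ^ 2 : ℝ) * ⟪ξ, π x ξ⟫_ℂ := by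
    apply Complex.ext
    · rw [hre, Complex.re_ofReal_mul]
    · have h3 := hre (Complex.I • x)
      rw [map_smul] at h3
      simp only [smul_apply, inner_smul_right, Complex.I_mul_re] at h3
      rw [Complex.im_ofReal_mul]
      linarith
  have horth (v : H) : ⟪ξ₁ - ((‖ξ₁‖ ^ 2 : ℝ) : ℂ) • ξ, v⟫_ℂ = 0 := by
    have hclosed : IsClosed {v : H | ⟪ξ₁ - ((‖ξ₁‖ ^ 2 : ℝ) : ℂ) • ξ, v⟫_ℂ = 0} :=
      isClosed_eq (by fun_prop) continuous_const
    refine closure_minimal ?_ hclosed (hcyc v)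
    rintro _ ⟨x, rfl⟩
    have h4 : ⟪ξ₁, π x ξ⟫_ℂ = ⟪ξ₁, π x ξ₁⟫_ℂ := by
      rw [hsum, map_add, inner_add_right, ho12, add_zero]
    change ⟪_, π x ξ⟫_ℂ = 0
    rw [inner_sub_left, inner_smul_left, Complex.conj_ofReal, h4, hcx, sub_self]
  have h5 : ξ₁ = ((‖ξ₁‖ ^ 2 : ℝ) : ℂ) • ξ :=
    sub_eq_zero.1 (inner_self_eq_zero.1 (horth _))
  have h6 : ((‖ξ₁‖ ^ 2 : ℝ) : ℂ) ≠ 0 := by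
    rw [Complex.ofReal_ne_zero]; positivity
  have h7 : ξ ∈ M := (M.smul_mem_iff h6).1 (h5 ▸ h₁)
  have h8 : ξ₂ ∈ M := by
    have : ξ₂ = ξ - ξ₁ := by rw [hsum]; abel
    rw [this]; exact M.sub_mem h7 h₁
  exact hz2 (inner_self_eq_zero.1 ((Submodule.mem_orthogonal M ξ₂).1 h₂ _ h8))

end Cyclic

/-! ### Primitive ideals containing a proper closed ideal -/

section Existence

universe v

/-- A proper closed ideal of a unital C⋆-algebra is annihilated by an irreducible representation
that does not annihilate a given element outside the ideal. -/
theorem exists_irreducible_unital {B : Type v} [CStarAlgebra B] (J : Submodule ℂ B)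
    (hJc : IsClosed (J : Set B)) (hJl : ∀ j ∈ J, ∀ x, x * j ∈ J) (hJr : ∀ j ∈ J, ∀ x, j * x ∈ J)
    (hJs : ∀ j ∈ J, star j ∈ J) {b : B} (hb : b ∉ J) :
    ∃ (H : Type v) (_ : NormedAddCommGroup H) (_ : InnerProductSpace ℂ H) (_ : CompleteSpace H)
      (π : B →⋆ₐ[ℂ] (H →L[ℂ] H)), π b ≠ 0 ∧ (∀ j ∈ J, π j = 0) ∧
      ∀ M : Submodule ℂ H, IsClosed (M : Set H) → (∀ x, ∀ v ∈ M, π x v ∈ M) → M = ⊥ ∨ M = ⊤ := by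
  let _ := CStarAlgebra.spectralOrder B
  have _ := CStarAlgebra.spectralOrderedRing B
  obtain ⟨f, hfe, hfb⟩ := exists_extreme_state J hJc hJl hJs hb
  obtain ⟨hf1, hf2, hf3, hf4⟩ := hfe.1
  let φ := complexState f hf1 hf2
  let π := φ.gnsStarAlgHom
  have hπ (x y : B) : π x (φ.toPreGNS y : φ.GNS) = (φ.toPreGNS (x * y) : φ.GNS) :=
    φ.gnsNonUnitalStarAlgHom_apply_coe
  let ξ : φ.GNS := (φ.toPreGNS 1 : φ.GNS)
  have hπξ (x : B) : π x ξ = (φ.toPreGNS x : φ.GNS) := by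
    rw [hπ, mul_one]
  have hin (x y : B) : ⟪(φ.toPreGNS x : φ.GNS), (φ.toPreGNS y : φ.GNS)⟫_ℂ = φ (star x * y) := by
    rw [UniformSpace.Completion.inner_coe]; rfl
  have hφ (x : B) : ⟪ξ, π x ξ⟫_ℂ = φ x := by
    rw [hπξ, hin, star_one, one_mul]
  have hφJ (j : B) (hj : j ∈ J) : φ j = 0 := by
    apply Complex.ext
    · rw [complexState_re]; exact hf4 j hj
    · rw [complexState_im, hf4 _ (J.smul_mem _ hj)]; simp
  have hξ : ‖ξ‖ = 1 := by
    have h1 : ⟪ξ, ξ⟫_ℂ = φ 1 := by rw [hin, star_one, one_mul]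
    have h2 : ‖ξ‖ ^ 2 = 1 := by
      rw [← hf3, ← complexState_re hf1 hf2 1]
      change _ = (φ 1).re
      rw [← h1]
      exact (inner_self_eq_norm_sq (𝕜 := ℂ) ξ).symm
    nlinarith [norm_nonneg ξ]
  have hdense : Dense (Set.range fun x => π x ξ) := by
    have : (Set.range fun x => π x ξ) = Set.range ((↑) : φ.PreGNS → φ.GNS) := by
      ext v
      constructor
      · rintro ⟨x, rfl⟩; exact ⟨φ.toPreGNS x, (hπξ x).symm⟩
      · rintro ⟨x, rfl⟩; exact ⟨φ.ofPreGNS x, hπξ _⟩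
    rw [this]
    exact UniformSpace.Completion.denseRange_coe
  have hπJ (j : B) (hj : j ∈ J) : π j = 0 := by
    have hzero (y : B) : π j (π y ξ) = 0 := by
      rw [hπξ, hπ, ← inner_self_eq_zero (𝕜 := ℂ), hin]
      exact hφJ _ (hJl _ (hJr _ hj _) _)
    refine ContinuousLinearMap.ext fun v => ?_
    have hcl : IsClosed {v | π j v = 0} := isClosed_eq (by fun_prop) continuous_const
    exact closure_minimal (by rintro _ ⟨y, rfl⟩; exact hzero y) hcl (hdense v)
  have hvs : vectorState π ξ = f := by
    refine DFunLike.ext _ _ fun x => ?_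
    rw [vectorState_apply, hξ, hφ, one_pow, inv_one, one_mul]
    exact complexState_re hf1 hf2 x
  refine ⟨φ.GNS, inferInstance, inferInstance, inferInstance, π, fun h0 => hfb ?_, hπJ,
    irreducible_of_extreme π hπJ hξ hdense (by rwa [hvs])⟩
  rw [← hvs, vectorState_apply, map_mul, h0]
  simp

/-- A proper closed ideal is contained in a primitive ideal. -/
theorem exists_prim_of_notMem {A : Type v} [NonUnitalCStarAlgebra A] (J : Submodule ℂ A)
    (hJc : IsClosed (J : Set A)) (hJl : ∀ j ∈ J, ∀ x, x * j ∈ J) (hJr : ∀ j ∈ J, ∀ x, j * x ∈ J)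
    (hJs : ∀ j ∈ J, star j ∈ J) {b : A} (hb : b ∉ J) : ∃ P : Prim A, J ≤ P.1 := by
  let I : Submodule ℂ (Unitization ℂ A) := J.map (Unitization.inrHom ℂ ℂ A)
  have hmem (j : A) (hj : j ∈ J) : (j : Unitization ℂ A) ∈ I := ⟨j, hj, rfl⟩
  have hIc : IsClosed (I : Set (Unitization ℂ A)) := by
    have hiso : Isometry ((↑) : A → Unitization ℂ A) := Unitization.isometry_inr
    exact hiso.isClosedEmbedding.isClosedMap _ hJc
  have hbI : (b : Unitization ℂ A) ∉ I := by
    rintro ⟨j, hj, hjb⟩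
    exact hb (Unitization.inr_injective hjb ▸ hj)
  obtain ⟨H, i1, i2, i3, π, hπb, hπI, hirr⟩ := exists_irreducible_unital I hIc
    (by
      rintro _ ⟨j, hj, rfl⟩ x
      induction x with
      | inl_add_inr r a =>
        rw [add_mul]
        refine I.add_mem ?_ ?_
        · change Unitization.inl r * (j : Unitization ℂ A) ∈ I
          rw [Unitization.inl_mul_inr]
          exact hmem _ (J.smul_mem _ hj)
        · change (a : Unitization ℂ A) * (j : Unitization ℂ A) ∈ I
          rw [← Unitization.inr_mul]
          exact hmem _ (hJl _ hj _))
    (by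
      rintro _ ⟨j, hj, rfl⟩ x
      induction x with
      | inl_add_inr r a =>
        rw [mul_add]
        refine I.add_mem ?_ ?_
        · change (j : Unitization ℂ A) * Unitization.inl r ∈ I
          rw [Unitization.inr_mul_inl]
          exact hmem _ (J.smul_mem _ hj)
        · change (j : Unitization ℂ A) * (a : Unitization ℂ A) ∈ I
          rw [← Unitization.inr_mul]
          exact hmem _ (hJr _ hj _))
    (by
      rintro _ ⟨j, hj, rfl⟩
      change star (j : Unitization ℂ A) ∈ I
      rw [← Unitization.inr_star]
      exact hmem _ (hJs _ hj)) hbI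
  let ρ : A →⋆ₙₐ[ℂ] (H →L[ℂ] H) :=
    (π : Unitization ℂ A →⋆ₙₐ[ℂ] (H →L[ℂ] H)).comp (Unitization.inrNonUnitalStarAlgHom ℂ A)
  have hρ (a : A) : ρ a = π a := rfl
  let P : Submodule ℂ A := LinearMap.ker (ρ : A →ₗ[ℂ] (H →L[ℂ] H))
  have hP (a : A) : a ∈ P ↔ ρ a = 0 := LinearMap.mem_ker
  refine ⟨⟨P, H, i1, i2, i3, ρ, ⟨⟨b, hπb⟩, fun M hMc hM => hirr M hMc fun x v hv => ?_⟩, hP⟩,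
    fun j hj => (hP j).2 (hπI _ (hmem j hj))⟩
  induction x with
  | inl_add_inr r a =>
    -- The adjoined unit acts by scalars, so a subspace invariant under `A` is invariant under the
    -- unitization, and irreducibility survives restriction to `A`.
    rw [map_add, add_apply]
    refine M.add_mem ?_ (hM a v hv)
    have : (Unitization.inl r : Unitization ℂ A) = algebraMap ℂ _ r := rfl
    rw [this, AlgHomClass.commutes, ContinuousLinearMap.algebraMap_apply]
    exact M.smul_mem _ hv

end Existence

end GlimmSpace

namespace GlimmSpace

open scoped InnerProductSpace

universe v

variable {A : Type v} [NonUnitalCStarAlgebra A]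

/-! ### Elementary properties of primitive ideals -/

theorem continuous_rep {H : Type*} [NormedAddCommGroup H] [InnerProductSpace ℂ H] [CompleteSpace H]
    (π : A →⋆ₙₐ[ℂ] (H →L[ℂ] H)) : Continuous π :=
  AddMonoidHomClass.continuous_of_bound π 1 fun a => by
    rw [one_mul]; exact NonUnitalStarAlgHom.norm_apply_le π a

theorem Prim.isClosed (P : Prim A) : IsClosed (P.1 : Set A) := by
  obtain ⟨H, _, _, _, π, -, hker⟩ := P.2
  have : (P.1 : Set A) = {a | π a = 0} := Set.ext hker
  rw [this]
  exact isClosed_eq (continuous_rep π) continuous_const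

theorem Prim.exists_notMem (P : Prim A) : ∃ b, b ∉ P.1 := by
  obtain ⟨H, _, _, _, π, ⟨⟨b, hb⟩, -⟩, hker⟩ := P.2
  exact ⟨b, fun h => hb ((hker b).1 h)⟩

/-- In the representation, `⟪v, (w⋆w + s⋆s) v⟫ = ‖w v‖² + ‖s v‖²`. This passes membership from a sum
of positive elements to its summands. -/
theorem Prim.mem_of_star_mul_self_add_mem (P : Prim A) {w s : A}
    (h : star w * w + star s * s ∈ P.1) : w ∈ P.1 := by
  obtain ⟨H, _, _, _, π, -, hker⟩ := P.2
  rw [hker] at h ⊢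
  have hin (x : A) (v : H) : ⟪v, π (star x * x) v⟫_ℂ = ((‖π x v‖ ^ 2 : ℝ) : ℂ) := by
    rw [map_mul, map_star, ContinuousLinearMap.star_eq_adjoint, mul_apply_eq_comp,
      ContinuousLinearMap.adjoint_inner_right, inner_self_eq_norm_sq_to_K]
    norm_cast
  refine ContinuousLinearMap.ext fun v => ?_
  have h1 : ⟪v, π (star w * w + star s * s) v⟫_ℂ = 0 := by rw [h]; simp
  rw [map_add, add_apply, inner_add_right, hin, hin, ← Complex.ofReal_add,
    Complex.ofReal_eq_zero] at h1
  have h2 : ‖π w v‖ ^ 2 = 0 := by nlinarith [sq_nonneg ‖π w v‖, sq_nonneg ‖π s v‖]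
  simpa using h2

theorem Prim.mem_of_sq_mem (P : Prim A) {z : A} (hz : z ∈ Set.center A) (h : z * z ∈ P.1) :
    z ∈ P.1 := by
  have := P.2.prime (x := z) (y := z) fun a => by
    rw [mul_assoc, ← Semigroup.mem_center_iff.1 hz a |>.symm, ← mul_assoc]
    exact (P.2.mul_mem h a a).2
  exact this.elim id id

/-! ### Ideals generated by central elements -/

/-- The closed ideal generated by a set of central elements. -/
def centralIdeal (W : Set A) : Submodule ℂ A :=
  (Submodule.span ℂ {y | ∃ w ∈ W, ∃ a, y = w * a}).topologicalClosure

/-- Homogeneity is required only up to some scalar `d`, so that the conjugate-linear `star` is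
covered together with left and right multiplication. -/
theorem mapsTo_centralIdeal {W : Set A} {g : A → A} (hg : Continuous g)
    (hadd : ∀ x y, g (x + y) = g x + g y) (hsmul : ∀ (c : ℂ) x, ∃ d : ℂ, g (c • x) = d • g x)
    (h : ∀ w ∈ W, ∀ a, ∃ w' ∈ W, ∃ b, g (w * a) = w' * b) {x : A} (hx : x ∈ centralIdeal W) :
    g x ∈ centralIdeal W := by
  have hz : g 0 = 0 := by simpa using hadd 0 0
  refine map_mem_closure hg hx (t := Submodule.span ℂ {y | ∃ w ∈ W, ∃ a, y = w * a}) ?_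
  intro y hy
  induction hy using Submodule.span_induction with
  | mem y hy =>
    obtain ⟨w, hw, a, rfl⟩ := hy
    exact Submodule.subset_span (h w hw a)
  | zero => rw [hz]; exact Submodule.zero_mem _
  | add y z _ _ hy hz => rw [hadd]; exact Submodule.add_mem _ hy hz
  | smul c y _ hy =>
    obtain ⟨d, hd⟩ := hsmul c y
    rw [hd]
    exact Submodule.smul_mem _ d hy

/-- Otherwise some primitive `P` contains the ideal, hence every `w * a * w`, and primeness gives `w
∈ P`. Without a unit, `w` is not visibly in the ideal itself. -/
theorem centralIdeal_eq_top {W : Set A} (hW : W ⊆ Set.center A) (hWs : ∀ w ∈ W, star w ∈ W)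
    (hP : ∀ P : Prim A, ¬ W ⊆ (P.1 : Set A)) : centralIdeal W = ⊤ := by
  refine eq_top_iff.2 fun b _ => ?_
  by_contra hb
  obtain ⟨P, hJP⟩ := exists_prim_of_notMem (centralIdeal W)
    (Submodule.isClosed_topologicalClosure _)
    (fun j hj x => mapsTo_centralIdeal (g := fun y => x * y) (by fun_prop)
      (mul_add x) (fun c y => ⟨c, mul_smul_comm c x y⟩) (fun w hw a => ⟨w, hw, x * a, by
        rw [← mul_assoc, Semigroup.mem_center_iff.1 (hW hw) x, mul_assoc]⟩) hj)
    (fun j hj x => mapsTo_centralIdeal (g := fun y => y * x) (by fun_prop)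
      (fun y z => add_mul y z x) (fun c y => ⟨c, smul_mul_assoc c y x⟩)
      (fun w hw a => ⟨w, hw, a * x, mul_assoc w a x⟩) hj)
    (fun j hj => mapsTo_centralIdeal (g := star) continuous_star star_add
      (fun c y => ⟨star c, star_smul c y⟩) (fun w hw a => ⟨star w, hWs w hw, star a, by
        rw [star_mul, Semigroup.mem_center_iff.1 (hW (hWs w hw))]⟩) hj) hb
  refine hP P fun w hw => ?_
  have := P.2.prime (x := w) (y := w) fun a => by
    rw [mul_assoc]
    exact hJP (Submodule.le_topologicalClosure _ (Submodule.subset_span ⟨w, hw, a * w, rfl⟩))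
  exact this.elim id id

/-- Membership of `y ∈ centralIdeal W` in primitive ideals is controlled by countably many elements
of `W`. -/
theorem exists_countable_of_mem_centralIdeal {W : Set A} {y : A} (hy : y ∈ centralIdeal W) :
    ∃ V ⊆ W, V.Countable ∧ ∀ P : Prim A, V ⊆ (P.1 : Set A) → y ∈ P.1 := by
  have hspan : ∀ x ∈ Submodule.span ℂ {y | ∃ w ∈ W, ∃ a, y = w * a},
      ∃ V ⊆ W, V.Countable ∧ ∀ P : Prim A, V ⊆ (P.1 : Set A) → x ∈ P.1 := by
    intro x hx
    induction hx using Submodule.span_induction with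
    | mem x hx =>
      obtain ⟨w, hw, a, rfl⟩ := hx
      exact ⟨{w}, by simpa using hw, Set.countable_singleton w,
        fun P hP => (P.2.mul_mem (hP rfl) a a).2⟩
    | zero => exact ⟨∅, Set.empty_subset _, Set.countable_empty, fun P _ => P.1.zero_mem⟩
    | add x y _ _ hx hy =>
      obtain ⟨V, hV, hVc, hVP⟩ := hx
      obtain ⟨U, hU, hUc, hUP⟩ := hy
      exact ⟨V ∪ U, Set.union_subset hV hU, hVc.union hUc, fun P hP =>
        P.1.add_mem (hVP P (Set.subset_union_left.trans hP))
          (hUP P (Set.subset_union_right.trans hP))⟩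
    | smul c x _ hx =>
      obtain ⟨V, hV, hVc, hVP⟩ := hx
      exact ⟨V, hV, hVc, fun P hP => P.1.smul_mem c (hVP P hP)⟩
  obtain ⟨u, hu, hlim⟩ := mem_closure_iff_seq_limit.1 hy
  choose V hV hVc hVP using fun n => hspan (u n) (hu n)
  exact ⟨⋃ n, V n, Set.iUnion_subset hV, Set.countable_iUnion hVc, fun P hP =>
    P.isClosed.mem_of_tendsto hlim (Filter.Eventually.of_forall fun n =>
      hVP n P ((Set.subset_iUnion V n).trans hP))⟩

/-- A primitive ideal containing the countably many central elements that control all `e n` would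
contain every `e n * b`, hence its limit `b`, and so be all of `A`. -/
theorem exists_seq_center (hq : IsQuasicentral A) (hA : HasCountableApproximateIdentity A) :
    ∃ w : ℕ → A, (∀ n, w n ∈ Set.center A) ∧ ∀ P : Prim A, ∃ n, w n ∉ P.1 := by
  obtain ⟨e, he⟩ := hA
  have htop : centralIdeal (Set.center A) = ⊤ :=
    centralIdeal_eq_top subset_rfl (fun w hw => Set.star_mem_center hw) hq
  choose V hV hVc hVP using fun n =>
    exists_countable_of_mem_centralIdeal (W := Set.center A) (y := e n) (htop ▸ Submodule.mem_top)
  -- Adding `0`, which is central and in every primitive ideal, makes the set nonempty and so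
  -- enumerable by `ℕ`.
  have hcount : (insert 0 (⋃ n, V n)).Countable := (Set.countable_iUnion hVc).insert 0
  obtain ⟨w, hw⟩ := hcount.exists_eq_range (Set.insert_nonempty _ _)
  refine ⟨w, fun n => ?_, fun P => ?_⟩
  · have : w n ∈ insert 0 (⋃ n, V n) := hw ▸ Set.mem_range_self n
    rcases this with h | h
    · rw [h]; exact Set.zero_mem_center
    · exact Set.iUnion_subset hV h
  · by_contra! hcon
    have hsub : (⋃ n, V n) ⊆ (P.1 : Set A) := fun x hx => by
      have : x ∈ Set.range w := hw ▸ Set.mem_insert_of_mem _ hx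
      obtain ⟨n, rfl⟩ := this
      exact hcon n
    obtain ⟨b, hb⟩ := P.exists_notMem
    have hlim : Filter.Tendsto (fun n => e n * b) Filter.atTop (nhds b) :=
      Filter.tendsto_map'_iff.1 (he.tendsto_mul_right b)
    exact hb (P.isClosed.mem_of_tendsto hlim (Filter.Eventually.of_forall fun n =>
      (P.2.mul_mem (hVP n P ((Set.subset_iUnion V n).trans hsub)) b b).2))

/-! ### The central element and its strict positivity -/

theorem exists_central_notMem_prim [PartialOrder A] [StarOrderedRing A] {w : ℕ → A}
    (hw : ∀ n, w n ∈ Set.center A) (hP : ∀ P : Prim A, ∃ n, w n ∉ P.1) :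
    ∃ z ∈ Set.center A, 0 ≤ z ∧ ∀ P : Prim A, z ∉ P.1 := by
  -- Positive weights giving `‖t n • w n‖ ≤ 2⁻ⁿ`, so the series of `star (u n) * u n` converges.
  let t (n : ℕ) : ℝ := (1 / 2) ^ n * (1 + ‖w n‖)⁻¹
  have ht (n : ℕ) : 0 < t n := by positivity
  let u (n : ℕ) : A := (t n : ℂ) • w n
  have hu (n : ℕ) : ‖u n‖ ≤ (1 / 2) ^ n := by
    rw [norm_smul, Complex.norm_real, Real.norm_of_nonneg (ht n).le, mul_assoc]
    refine mul_le_of_le_one_right (by positivity) ?_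
    rw [inv_mul_le_iff₀ (by positivity)]
    linarith
  have huc (n : ℕ) : u n ∈ Set.center A := by
    refine Semigroup.mem_center_iff.2 fun g => ?_
    rw [mul_smul_comm, smul_mul_assoc, Semigroup.mem_center_iff.1 (hw n)]
  let s (n : ℕ) : A := star (u n) * u n
  have hs0 (n : ℕ) : 0 ≤ s n := star_mul_self_nonneg _
  have hsum : Summable s := by
    refine Summable.of_norm_bounded (summable_geometric_of_lt_one (r := 1 / 2) (by norm_num)
      (by norm_num)) fun n => ?_
    rw [CStarRing.norm_star_mul_self]
    have h1 : ((1 : ℝ) / 2) ^ n ≤ 1 := pow_le_one₀ (by norm_num) (by norm_num)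
    nlinarith [hu n, norm_nonneg (u n)]
  refine ⟨∑' n, s n, Semigroup.mem_center_iff.2 fun g => ?_, tsum_nonneg hs0, fun P hzP => ?_⟩
  · rw [← hsum.tsum_mul_left, ← hsum.tsum_mul_right]
    exact tsum_congr fun n =>
      Semigroup.mem_center_iff.1 (Set.mul_mem_center (Set.star_mem_center (huc n)) (huc n)) g
  · obtain ⟨n, hn⟩ := hP P
    have hle : s n ≤ ∑' n, s n := hsum.le_tsum n fun m _ => hs0 m
    obtain ⟨r, hr⟩ := CStarAlgebra.nonneg_iff_eq_star_mul_self.1 (sub_nonneg.2 hle)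
    have h1 : u n ∈ P.1 := P.mem_of_star_mul_self_add_mem (s := r) (by
      rw [← hr]
      change s n + _ ∈ P.1
      rwa [add_sub_cancel])
    exact hn ((P.1.smul_mem_iff (Complex.ofReal_ne_zero.2 (ht n).ne')).1 h1)

/-- The square `z * z` escapes every primitive ideal with `z`, so its multiples `z * z * a = z * a *
z` are dense. -/
theorem isStrictlyPositiveFor_of_notMem_prim [PartialOrder A] {z : A} (hz : z ∈ Set.center A)
    (h0 : IsSelfAdjoint z) (hnn : 0 ≤ z) (hP : ∀ P : Prim A, z ∉ P.1) :
    IsStrictlyPositiveFor z := by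
  refine ⟨hnn, ?_⟩
  have hzz : z * z ∈ Set.center A := Set.mul_mem_center hz hz
  have htop : centralIdeal {z * z} = ⊤ := by
    refine centralIdeal_eq_top (by simpa using hzz) ?_ fun P hsub =>
      hP P (P.mem_of_sq_mem hz (hsub rfl))
    rintro w rfl
    rw [star_mul, h0.star_eq]
    rfl
  let R : Submodule ℂ A := LinearMap.range (LinearMap.mulLeft ℂ (z * z))
  have hR : (R : Set A) ⊆ {y | ∃ x, y = z * x * z} := by
    rintro _ ⟨x, rfl⟩
    refine ⟨x, ?_⟩
    rw [mul_assoc z x z, Semigroup.mem_center_iff.1 hz x, ← mul_assoc]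
    rfl
  have hle : Submodule.span ℂ {y | ∃ w ∈ ({z * z} : Set A), ∃ a, y = w * a} ≤ R := by
    refine Submodule.span_le.2 ?_
    rintro _ ⟨w, rfl, a, rfl⟩
    exact ⟨a, rfl⟩
  intro y
  have hy : y ∈ centralIdeal {z * z} := htop ▸ Submodule.mem_top
  exact closure_mono (fun x hx => hR (hle hx)) hy

/-! ### The scalar action of a central element, and compact sets of Glimm ideals -/

/-- A self-adjoint central element acts as a real scalar modulo a primitive ideal. -/
theorem exists_scalar {z : A} (hz : z ∈ Set.center A) (h0 : IsSelfAdjoint z) (P : Prim A) :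
    ∃ r : ℝ, (∀ f : ℝ → ℝ, Continuous f → f 0 = 0 → (cfcₙ f z ∈ P.1 ↔ f r = 0)) ∧
      ∀ a, a - z ∈ P.1 → |r| ≤ ‖a‖ := by
  obtain ⟨H, _, _, _, π, ⟨⟨b, hb⟩, hirr⟩, hker⟩ := P.2
  have _ : Nontrivial H := by
    obtain ⟨x, hx⟩ : ∃ x, π b x ≠ 0 := by
      by_contra! h
      exact hb (ContinuousLinearMap.ext h)
    exact ⟨_, _, hx⟩
  have hT : IsSelfAdjoint (π z) := h0.map π
  have hcomm (f : ℝ → ℝ) (a : A) : Commute (cfc f (π z)) (π a) := by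
    refine Commute.cfc_real ?_ f
    change π z * π a = π a * π z
    rw [← map_mul, ← map_mul, Semigroup.mem_center_iff.1 hz]
  -- Schur's argument: `cfc f (π z)` commutes with `π(A)`, so its kernel is invariant, hence zero or
  -- everything. When the kernel is zero, the vanishing product kills `cfc g (π z)`.
  have hkey (f g : ℝ → ℝ) (hf : Continuous f) (hg : Continuous g) (hfg : ∀ t, f t * g t = 0) :
      cfc f (π z) = 0 ∨ cfc g (π z) = 0 := by
    let M : Submodule ℂ H := LinearMap.ker (cfc f (π z)).toLinearMap
    have hprod : cfc f (π z) * cfc g (π z) = 0 := by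
      rw [← cfc_mul f g _ hf.continuousOn hg.continuousOn]
      simp only [hfg]
      exact cfc_const_zero ℝ _
    rcases hirr M (ContinuousLinearMap.isClosed_ker _) (fun a x hx => by
      have h1 : (cfc f (π z) * π a) x = (π a * cfc f (π z)) x := by rw [hcomm f a]
      have h2 : cfc f (π z) x = 0 := hx
      change cfc f (π z) (π a x) = 0
      rw [mul_apply_eq_comp, mul_apply_eq_comp, h2, map_zero] at h1
      exact h1) with h | h
    · right
      refine ContinuousLinearMap.ext fun x => ?_
      have h1 : cfc g (π z) x ∈ M := by
        change (cfc f (π z) * cfc g (π z)) x = 0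
        rw [hprod]; rfl
      rw [h] at h1
      simpa using h1
    · left
      refine ContinuousLinearMap.ext fun x => ?_
      have h1 : x ∈ M := h ▸ Submodule.mem_top
      exact h1
  have hne (f : ℝ → ℝ) (hf : Continuous f) (s : ℝ) (hs : s ∈ spectrum ℝ (π z))
      (h : cfc f (π z) = 0) : f s = 0 := by
    have h1 : f s ∈ spectrum ℝ (cfc f (π z)) := by
      rw [cfc_map_spectrum f (π z) hT hf.continuousOn]
      exact ⟨s, hs, rfl⟩
    rw [h, spectrum.zero_eq] at h1
    exact h1
  -- Two spectral points would be separated by functions supported on opposite sides of their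
  -- midpoint, contradicting `hkey`.
  have hsub (s t : ℝ) (hs : s ∈ spectrum ℝ (π z)) (ht : t ∈ spectrum ℝ (π z)) : ¬ s < t := by
    intro hst
    let m := (s + t) / 2
    rcases hkey (fun x => max (m - x) 0) (fun x => max (x - m) 0) (by fun_prop) (by fun_prop)
      (fun x => by
        rcases le_total x m with h | h
        · rw [max_eq_right (by linarith : x - m ≤ 0), mul_zero]
        · rw [max_eq_right (by linarith : m - x ≤ 0), zero_mul]) with h | h
    · have := hne _ (by fun_prop) s hs h
      have h2 := le_max_left (m - s) 0
      simp only [m] at *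
      linarith
    · have := hne _ (by fun_prop) t ht h
      have h2 := le_max_left (t - m) 0
      simp only [m] at *
      linarith
  obtain ⟨r, hr⟩ : (spectrum ℝ (π z)).Nonempty := 
    ContinuousFunctionalCalculus.spectrum_nonempty (π z) hT
  have hzr : π z = algebraMap ℝ (H →L[ℂ] H) r := by
    rw [← cfc_const r (π z) hT]
    conv_lhs => rw [← cfc_id ℝ (π z) hT]
    refine cfc_congr fun x hx => ?_
    exact le_antisymm (not_lt.1 (hsub r x hr hx)) (not_lt.1 (hsub x r hx hr))
  refine ⟨r, fun f hf hf0 => ?_, fun a ha => ?_⟩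
  · rw [hker, NonUnitalStarAlgHomClass.map_cfcₙ π f z hf.continuousOn hf0 (continuous_rep π) h0 hT,
      cfcₙ_eq_cfc hf.continuousOn hf0, hzr, cfc_algebraMap]
    exact FaithfulSMul.algebraMap_eq_zero_iff ℝ _
  · rw [hker, map_sub, sub_eq_zero] at ha
    have := NonUnitalStarAlgHom.norm_apply_le π a
    rw [ha, hzr, norm_algebraMap', Real.norm_eq_abs] at this
    exact this

theorem exists_boundedContinuousFunction {z : A} (hz : z ∈ Set.center A) (h0 : IsSelfAdjoint z)
    (hP : ∀ P : Prim A, z ∉ P.1) :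
    ∃ f : BoundedContinuousFunction (Prim A) ℝ, ∀ P : Prim A, f P ≠ 0 ∧
      ∀ a, a - z ∈ P.1 → |f P| ≤ ‖a‖ := by
  choose r hr hra using exists_scalar hz h0
  have hr0 (P : Prim A) : r P ≠ 0 := fun h => hP P (by
    have := (hr P id continuous_id rfl).2 h
    rwa [cfcₙ_id ℝ z h0] at this)
  -- The complement is the hull of the single element `cfcₙ f z`.
  have hopen (f : ℝ → ℝ) (hf : Continuous f) (hf0 : f 0 = 0) : IsOpen {P : Prim A | f (r P) ≠ 0} := by
    rw [← isClosed_compl_iff, isClosed_iff_hull]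
    refine ⟨{cfcₙ f z}, Set.ext fun P => ?_⟩
    simp only [hull, Set.mem_compl_iff, Set.mem_ofPred_eq, not_not, Set.singleton_subset_iff,
      SetLike.mem_coe]
    exact (hr P f hf hf0).symm
  have hcont : Continuous r := by
    refine OrderTopology.continuous_iff.2 fun c => ⟨?_, ?_⟩
    -- The factor `t` secures `f 0 = 0`, as the non-unital calculus demands. It does not change the
    -- set, because `r P ≠ 0`.
    · convert hopen (fun t => t * max (t - c) 0) (by fun_prop) (by simp) using 1
      ext P
      simp [hr0 P]
    · convert hopen (fun t => t * max (c - t) 0) (by fun_prop) (by simp) using 1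
      ext P
      simp [hr0 P]
  refine ⟨BoundedContinuousFunction.ofNormedAddCommGroup r hcont ‖z‖ fun P => ?_,
    fun P => ⟨hr0 P, hra P⟩⟩
  exact hra P z (by rw [sub_self]; exact P.1.zero_mem)

theorem continuous_of_comp_quotientMap {g : Glimm A → ℝ}
    (f : BoundedContinuousFunction (Prim A) ℝ) (h : ∀ P, g (quotientMap P) = f P) :
    Continuous g :=
  continuous_iInf_dom (i := ⟨g, f, h⟩) continuous_induced_dom

theorem glimmIdeal_le (P : Prim A) : glimmIdeal P ≤ P.1 :=
  iInf_le (fun Q : {Q : Prim A // Equivalent Q P} => Q.1.1) ⟨P, fun _ => rfl⟩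

theorem exists_le_norm_of_isCompact {z : A} (hz : z ∈ Set.center A) (h0 : IsSelfAdjoint z)
    (hP : ∀ P : Prim A, z ∉ P.1) {K : Set (Glimm A)} (hK : IsCompact K) :
    ∃ α : ℝ, 0 < α ∧ K ⊆ {G : Glimm A | α ≤ ‖(Submodule.Quotient.mk z : A ⧸ G.1)‖} := by
  obtain ⟨f, hf⟩ := exists_boundedContinuousFunction hz h0 hP
  obtain ⟨g, hg⟩ := exists_drop f
  have hgc : Continuous g := continuous_of_comp_quotientMap f hg
  rcases K.eq_empty_or_nonempty with rfl | hne
  · exact ⟨1, one_pos, Set.empty_subset _⟩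
  obtain ⟨G₀, -, hmin⟩ := hK.exists_isMinOn hne hgc.abs.continuousOn
  refine ⟨|g G₀|, ?_, fun G hG => ?_⟩
  · obtain ⟨_, P, rfl⟩ := G₀
    exact abs_pos.2 ((hg P).trans_ne (hf P).1)
  · have hle : |g G₀| ≤ |g G| := hmin hG
    rw [Set.mem_ofPred_eq]
    refine hle.trans ?_
    obtain ⟨_, P, rfl⟩ := G
    change |g (quotientMap P)| ≤ _
    rw [hg]
    -- The quotient norm is an infimum over lifts `a` of the class of `z`. Each lift agrees with `z`
    -- modulo `P` as well, so `|f P| ≤ ‖a‖`.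
    refine le_of_forall_pos_lt_add fun ε hε => ?_
    obtain ⟨a, ha, hlt⟩ := Submodule.Quotient.norm_mk_lt
      (Submodule.Quotient.mk z : A ⧸ glimmIdeal P) hε
    exact ((hf P).2 a (glimmIdeal_le P ((Submodule.Quotient.eq _).1 ha))).trans_lt hlt

end GlimmSpace

theorem mainTheorem2 {A : Type*} [NonUnitalCStarAlgebra A] [PartialOrder A] [StarOrderedRing A]
    (hq : GlimmSpace.IsQuasicentral A) (hA : GlimmSpace.HasCountableApproximateIdentity A) :
    ∃ z : A, z ∈ Set.center A ∧ GlimmSpace.IsStrictlyPositiveFor z ∧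
      ∀ K : Set (GlimmSpace.Glimm A), IsCompact K →
        ∃ α : ℝ, 0 < α ∧
          K ⊆ {G : GlimmSpace.Glimm A | α ≤ ‖(Submodule.Quotient.mk z : A ⧸ G.1)‖} := by
  obtain ⟨w, hw, hwP⟩ := GlimmSpace.exists_seq_center hq hA
  obtain ⟨z, hz, h0, hzP⟩ := GlimmSpace.exists_central_notMem_prim hw hwP
  have hsa : IsSelfAdjoint z := .of_nonneg h0
  exact ⟨z, hz, GlimmSpace.isStrictlyPositiveFor_of_notMem_prim hz hsa h0 hzP, fun K hK =>
    GlimmSpace.exists_le_norm_of_isCompact hz hsa hzP hK⟩
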